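/- Let $T>0$, $\omega=2\pi/T$, $n\in\mathbb N$, and let $A:\mathbb R\to\mathbb C^{n\times n}$ be $T$-periodic with $A\in L^\infty([0,T],\mathbb C^{n\times n})$. For $k\in\mathbb Z$ put $a_{ij,k}=\frac1T\int_0^T a_{ij}(\tau)e^{-\mathrm{i}\omega k\tau}\,d\tau$. Let $\mathcal A$ be the infinite block Toeplitz matrix with $n\times n$ blocks $\mathcal A_{ij}=(a_{ij,k-p})_{k,p\in\mathbb Z}$, and let $\mathcal N=\mathrm{Id}_n\otimes\mathrm{diag}(\mathrm{i}\omega k,\ k\in\mathbb Z)$. Regard $\mathcal A-\mathcal N$ as an unbounded operator on $\ell^2=\ell^2(\{1,\dots,n\}\times\mathbb Z,\mathbb C)$ with its maximal domain $\{X\in\ell^2:(\mathcal A-\mathcal N)X\in\ell^2\}$; it is called invertible if it maps this domain bijectively onto $\ell^2$. For $m\in\mathbb N$ let $\mathcal A_m$ and $\mathcal N_m$ be the $n(2m+1)\times n(2m+1)$ matrices obtained from $\mathcal A$ and $\mathcal N$ by keeping in every block only the rows and columns with index in $\{-m,\dots,m\}$. If $\mathcal A-\mathcal N$ is invertible, then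 there exists $m_0>0$ such that for every $m\ge m_0$ the matrix $\mathcal A_m-\mathcal N_m$ is invertible; moreover $$\sup_{m\ge m_0}\bigl\|(\mathcal A_m-\mathcal N_m)^{-1}\bigr\|_{\ell^2}<+\infty,$$ where $\|\cdot\|_{\ell^2}$ is the operator norm induced by the Euclidean norm. -/

import Mathlib

open scoped Kronecker ENNReal Matrix.Norms.L2Operator

noncomputable section

namespace HarmonicOperator

/-- The `k`-th phasor `a_k = (1/T) ∫_0^T a(τ) e^{-jωkτ} dτ`, `ω = 2π/T`, of a `T`-periodic
signal `a` (by periodicity the window `[t - T, t]` may be taken to be `[0, T]`). -/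
def phasor (T : ℝ) (a : ℝ → ℂ) (k : ℤ) : ℂ :=
  (1 / (T : ℂ)) *
    ∫ τ in (0 : ℝ)..T, a τ * Complex.exp (-Complex.I * ((2 * Real.pi / T * k * τ : ℝ) : ℂ))

/-- The block Toeplitz matrix of `A`: its block `(i, j)` is the doubly infinite Toeplitz matrix
`(a_{ij, k - p})_{k, p ∈ ℤ}` of the phasors of the entry `a_{ij}`. -/
def blockToeplitz {n : ℕ} (T : ℝ) (A : ℝ → Matrix (Fin n) (Fin n) ℂ) :
    Matrix (Fin n × ℤ) (Fin n × ℤ) ℂ :=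
  Matrix.of fun r c => phasor T (fun t => A t r.1 c.1) (r.2 - c.2)

/-- The diagonal matrix `Id_n ⊗ diag(jωk, k ∈ ℤ)`, `ω = 2π/T`. -/
def harmonicDiag (n : ℕ) (T : ℝ) : Matrix (Fin n × ℤ) (Fin n × ℤ) ℂ :=
  (1 : Matrix (Fin n) (Fin n) ℂ) ⊗ₖ
    Matrix.diagonal fun k : ℤ => Complex.I * ((2 * Real.pi / T * k : ℝ) : ℂ)

/-- Indices of the `m`-truncation: pairs `(i, k)` with `-m ≤ k ≤ m`. -/
abbrev TruncIndex (n m : ℕ) : Type := Fin n × ↥(Finset.Icc (-(m : ℤ)) (m : ℤ))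

/-- The `m`-truncation of an infinite `n × n` block matrix: every block is restricted to the rows
and columns of index in `{-m, …, m}`. -/
def trunc {n : ℕ} (m : ℕ) (M : Matrix (Fin n × ℤ) (Fin n × ℤ) ℂ) :
    Matrix (TruncIndex n m) (TruncIndex n m) ℂ :=
  M.submatrix (fun r => (r.1, (r.2 : ℤ))) (fun c => (c.1, (c.2 : ℤ)))

/-- `ℓ²` sequences indexed by `ι`. -/
abbrev Ell2 (ι : Type) : Type := lp (fun _ : ι => ℂ) 2

/-- The (in general unbounded) operator on `ℓ²` given by an infinite matrix `M`, with its maximal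
domain: those `X ∈ ℓ²` for which all the series `∑_c M_{rc} X_c` converge (absolutely) and the
sequence `MX` of their sums is again in `ℓ²`. -/
def matrixOp {ι : Type} (M : Matrix ι ι ℂ) : Ell2 ι →ₗ.[ℂ] Ell2 ι where
  domain :=
    { carrier := {X | (∀ r, Summable fun c => M r c * X c) ∧
        Memℓp (fun r => ∑' c, M r c * X c) 2}
      zero_mem' := by
        refine ⟨fun r => by simp, ?_⟩
        simp only [lp.coeFn_zero, Pi.zero_apply, mul_zero, tsum_zero]
        exact (zero_memℓp : Memℓp (0 : ι → ℂ) 2)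
      add_mem' := by
        rintro X Y ⟨hX, hX'⟩ ⟨hY, hY'⟩
        refine ⟨fun r => by simpa [mul_add] using (hX r).add (hY r), ?_⟩
        have h := hX'.add hY'
        convert h using 1
        funext r
        simpa [mul_add] using (hX r).tsum_add (hY r)
      smul_mem' := by
        rintro a X ⟨hX, hX'⟩
        refine ⟨fun r => by simpa [mul_left_comm] using (hX r).mul_left a, ?_⟩
        have h := hX'.const_smul a
        convert h using 1
        funext r
        simp [mul_left_comm, tsum_mul_left] }
  toFun :=
    { toFun := fun X => ⟨fun r => ∑' c, M r c * (X : Ell2 ι) c, X.2.2⟩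
      map_add' := by
        intro X Y
        ext r
        change ∑' c, M r c * ((X : Ell2 ι) c + (Y : Ell2 ι) c) =
          ∑' c, M r c * (X : Ell2 ι) c + ∑' c, M r c * (Y : Ell2 ι) c
        simpa only [mul_add] using (X.2.1 r).tsum_add (Y.2.1 r)
      map_smul' := by
        intro a X
        ext r
        simp [mul_left_comm, tsum_mul_left] }

/-- The operator on `ℓ²` given by `M` is invertible: it maps its domain bijectively onto `ℓ²`. -/
def IsInvertibleOp {ι : Type} (M : Matrix ι ι ℂ) : Prop :=
  Function.Bijective (matrixOp M : (matrixOp M).domain → Ell2 ι)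

end HarmonicOperator

end

namespace HarmonicOperator

open Filter Topology

/-! The argument is by compactness. If the truncations are not uniformly bounded below, there are
unit vectors, on ever larger truncations, with images tending to zero. The rows of the Toeplitz part
are uniformly bounded in `ℓ²`, so the diagonal part of each equation forces the entries to decay
like `1 / (1 + ‖d r‖)`. This common square-summable majorant prevents loss of mass: a coordinatewise
limit still has norm one, and it lies in the kernel of the full operator, contradicting injectivity
(`exists_finiteSection_bounded_below`). Since truncations are square, a uniform lower bound gives
inverses with a uniform norm bound (`isUnit_and_norm_inv_le_of_bounded_below`). -/

/-- A product of two square-summable families is summable. -/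
theorem summable_mul_of_summable_sq {ι : Type*} {f g : ι → ℝ}
    (hf : Summable fun i => f i ^ 2) (hg : Summable fun i => g i ^ 2) :
    Summable fun i => f i * g i := by
  refine Summable.of_norm_bounded (hf.add hg) fun i => ?_
  rw [Real.norm_eq_abs, abs_le]
  constructor <;> nlinarith [sq_nonneg (f i + g i), sq_nonneg (f i - g i), sq_nonneg (f i),
    sq_nonneg (g i)]

/-- Summing against an extension by zero along an injection. -/
theorem tsum_mul_extend {ι κ : Type*} [Fintype κ] {e : κ → ι} (he : Function.Injective e)
    (a : ι → ℂ) (v : κ → ℂ) :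
    ∑' c, a c * Function.extend e v 0 c = ∑ k, a (e k) * v k := by
  rw [← he.tsum_eq, tsum_fintype]
  · simp [he.extend_apply]
  · intro c hc
    by_contra h
    exact hc (by simp [Function.extend_apply' v (0 : ι → ℂ) c h])

theorem tsum_norm_sq_extend {ι κ : Type*} [Fintype κ] {e : κ → ι} (he : Function.Injective e)
    (v : κ → ℂ) :
    ∑' c, ‖Function.extend e v 0 c‖ ^ 2 = ∑ k, ‖v k‖ ^ 2 := by
  rw [← he.tsum_eq, tsum_fintype]
  · simp [he.extend_apply]
  · intro c hc
    by_contra h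
    exact hc (by simp [Function.extend_apply' v (0 : ι → ℂ) c h])

/-- Cauchy–Schwarz inequality for a row of a matrix against a unit vector. -/
theorem norm_sum_mul_le_of_sq_le {ι κ : Type*} [Fintype κ] {e : κ → ι}
    (he : Function.Injective e) {a : ι → ℂ} {K : ℝ} (hK : 0 ≤ K)
    (ha : Summable fun c => ‖a c‖ ^ 2) (haK : ∑' c, ‖a c‖ ^ 2 ≤ K ^ 2)
    {v : κ → ℂ} (hv : ∑ k, ‖v k‖ ^ 2 = 1) :
    ‖∑ k, a (e k) * v k‖ ≤ K := by
  have h1 : ‖∑ k, a (e k) * v k‖ ≤ ∑ k, ‖a (e k)‖ * ‖v k‖ := by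
    simpa only [norm_mul] using norm_sum_le Finset.univ fun k => a (e k) * v k
  have h2 := Finset.sum_mul_sq_le_sq_mul_sq Finset.univ (fun k => ‖a (e k)‖) fun k => ‖v k‖
  have h3 : ∑ k, ‖a (e k)‖ ^ 2 ≤ ∑' c, ‖a c‖ ^ 2 := by
    rw [← tsum_fintype (L := .unconditional _)]
    exact tsum_comp_le_tsum_of_inj ha (fun c => by positivity) he
  rw [hv, mul_one] at h2
  exact h1.trans (abs_le_of_sq_le_sq' (h2.trans (h3.trans haK)) hK).2

/-! ### Uniform lower bounds for finite sections -/

/-- Finite sections of `L - diagonal d`, with `d` growing fast enough and the rows of `L`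
uniformly bounded in `ℓ²`, are eventually uniformly bounded below if `L - diagonal d` has trivial
kernel in `ℓ²`. -/
theorem exists_finiteSection_bounded_below {ι : Type*} [Countable ι] [DecidableEq ι]
    {κ : ℕ → Type*} [∀ m, Fintype (κ m)] (e : ∀ m, κ m → ι)
    (he : ∀ m, Function.Injective (e m)) (hex : ∀ r, ∀ᶠ m in atTop, r ∈ Set.range (e m))
    (L : Matrix ι ι ℂ) (d : ι → ℂ) {K : ℝ} (hK : 0 ≤ K)
    (hL : ∀ r, Summable fun c => ‖L r c‖ ^ 2) (hLK : ∀ r, ∑' c, ‖L r c‖ ^ 2 ≤ K ^ 2)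
    (hd : Summable fun r => (1 / (1 + ‖d r‖)) ^ 2)
    (hker : ∀ X : ι → ℂ, Summable (fun c => ‖X c‖ ^ 2) →
      (∀ r, Summable fun c => (L - Matrix.diagonal d) r c * X c) →
      (∀ r, ∑' c, (L - Matrix.diagonal d) r c * X c = 0) → X = 0) :
    ∃ m₀ : ℕ, ∃ δ : ℝ, 0 < δ ∧ ∀ m ≥ m₀, ∀ v : EuclideanSpace ℂ (κ m),
      δ * ‖v‖ ≤ ‖WithLp.toLp 2
        (((L - Matrix.diagonal d).submatrix (e m) (e m)).mulVec v.ofLp)‖ := by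
  set M : Matrix ι ι ℂ := L - Matrix.diagonal d with hM
  have hMsq : ∀ r, Summable fun c => ‖M r c‖ ^ 2 := by
    intro r
    have : (fun c => ‖M r c‖ ^ 2) =
        fun c => ‖L r c‖ ^ 2 + if c = r then ‖M r r‖ ^ 2 - ‖L r r‖ ^ 2 else 0 := by
      funext c
      by_cases h : c = r
      · subst h; simp
      · simp [hM, h, Matrix.diagonal_apply_ne' d h]
    rw [this]
    exact (hL r).add (summable_of_hasFiniteSupport
      ((Set.finite_singleton r).subset fun c hc => by
        by_contra h
        exact hc (if_neg h)))
  by_contra! hcon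
  have hunit : ∀ N : ℕ, ∃ m ≥ N, ∃ v : κ m → ℂ, ∑ k, ‖v k‖ ^ 2 = 1 ∧
      ∀ k, ‖∑ l, M (e m k) (e m l) * v l‖ ≤ 1 / ((N : ℝ) + 1) := by
    intro N
    obtain ⟨m, hm, v, hv⟩ := hcon N (1 / ((N : ℝ) + 1)) (by positivity)
    have hv0 : 0 < ‖v‖ := by
      by_contra h
      have h0 : v = 0 := by simpa using h
      simp [h0] at hv
    refine ⟨m, hm, ((‖v‖⁻¹ : ℂ) • v).ofLp, ?_, fun k => ?_⟩
    · rw [← EuclideanSpace.norm_sq_eq, norm_smul]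
      simp [hv0.ne']
    · have h1 := PiLp.norm_apply_le
        (WithLp.toLp 2 ((M.submatrix (e m) (e m)).mulVec v.ofLp)) k
      have h2 := h1.trans hv.le
      have h3 : ∑ l, M (e m k) (e m l) * ((‖v‖⁻¹ : ℂ) • v).ofLp l =
          (‖v‖⁻¹ : ℂ) * (M.submatrix (e m) (e m)).mulVec v.ofLp k := by
        simp [Matrix.mulVec, dotProduct, Finset.mul_sum, mul_left_comm]
      rw [h3, norm_mul, norm_inv, Complex.norm_real, norm_norm]
      rw [inv_mul_le_iff₀ hv0, mul_comm]
      exact h2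
  choose m hm v hv1 hvs using hunit
  set x : ℕ → ι → ℂ := fun N => Function.extend (e (m N)) (v N) 0 with hx
  -- In `K + 2`, `K` bounds the row of `L` against a unit vector, one unit bounds the residual, and
  -- one bounds the entry itself.
  set g : ι → ℝ := fun r => (K + 2) * (1 / (1 + ‖d r‖)) with hg
  have hgsq : Summable fun r => g r ^ 2 := by
    simpa only [hg, mul_pow] using hd.mul_left ((K + 2) ^ 2)
  have hmt : Tendsto m atTop atTop := tendsto_atTop_mono hm tendsto_id
  have hx1 : ∀ N, ∑' c, ‖x N c‖ ^ 2 = 1 := fun N => by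
    rw [← hv1 N]; exact tsum_norm_sq_extend (he _) _
  have hxM : ∀ N r, r ∈ Set.range (e (m N)) → ‖∑' c, M r c * x N c‖ ≤ 1 / ((N : ℝ) + 1) := by
    rintro N _ ⟨k, rfl⟩
    rw [tsum_mul_extend (he _)]
    exact hvs N k
  have hxg : ∀ N r, ‖x N r‖ ≤ g r := by
    intro N r
    by_cases hr : r ∈ Set.range (e (m N))
    · obtain ⟨k, rfl⟩ := hr
      have hxk : x N (e (m N) k) = v N k := (he _).extend_apply _ _ _
      rw [hxk]
      have h1 : ‖v N k‖ ≤ 1 := by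
        have := Finset.single_le_sum (f := fun k => ‖v N k‖ ^ 2) (fun i _ => by positivity)
          (Finset.mem_univ k)
        rw [hv1 N] at this
        exact (sq_le_one_iff₀ (norm_nonneg _)).1 this
      have h2 := norm_sum_mul_le_of_sq_le (he (m N)) hK (hL (e (m N) k)) (hLK _) (hv1 N)
      have h3 : ∑ l, M (e (m N) k) (e (m N) l) * v N l =
          ∑ l, L (e (m N) k) (e (m N) l) * v N l - d (e (m N) k) * v N k := by
        classical
        simp only [hM, Matrix.sub_apply, sub_mul, Finset.sum_sub_distrib, Matrix.diagonal_apply,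
          (he (m N)).eq_iff]
        simp
      have h4 := hvs N k
      rw [h3] at h4
      have h5 : (1 : ℝ) / ((N : ℝ) + 1) ≤ 1 := by
        rw [div_le_one (by positivity)]
        have : (0 : ℝ) ≤ N := Nat.cast_nonneg N
        linarith
      have h6 := norm_sub_norm_le (d (e (m N) k) * v N k)
        (∑ l, L (e (m N) k) (e (m N) l) * v N l)
      rw [norm_sub_rev, norm_mul] at h6
      have h7 : (0 : ℝ) < 1 + ‖d (e (m N) k)‖ := by positivity
      rw [hg]
      simp only
      rw [mul_one_div, le_div_iff₀ h7]
      nlinarith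
    · have : x N r = 0 := by simp [hx, Function.extend_apply' _ _ _ hr]
      rw [this, norm_zero]
      positivity
  -- Tychonoff; countability of `ι` makes the product of discs sequentially compact.
  obtain ⟨X, -, φ, hφ, hlim⟩ := (isCompact_univ_pi fun r =>
    isCompact_closedBall (0 : ℂ) (g r)).tendsto_subseq (x := x)
      fun N r _ => by simpa using hxg N r
  have hlimr : ∀ r, Tendsto (fun N => x (φ N) r) atTop (𝓝 (X r)) := tendsto_pi_nhds.1 hlim
  have hXg : ∀ r, ‖X r‖ ≤ g r := fun r =>
    le_of_tendsto (hlimr r).norm (Eventually.of_forall fun N => hxg _ r)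
  have hg0 : ∀ r, 0 ≤ g r := fun r => (norm_nonneg _).trans (hXg r)
  have hXsq : Summable fun c => ‖X c‖ ^ 2 :=
    hgsq.of_nonneg_of_le (fun c => by positivity)
      fun c => pow_le_pow_left₀ (norm_nonneg _) (hXg c) 2
  have hX1 : ∑' c, ‖X c‖ ^ 2 = 1 := by
    have h := tendsto_tsum_of_dominated_convergence (𝓕 := atTop)
      (f := fun N c => ‖x (φ N) c‖ ^ 2) (g := fun c => ‖X c‖ ^ 2) hgsq
      (fun c => ((hlimr c).norm).pow 2) (Eventually.of_forall fun N c => by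
        rw [norm_pow, norm_norm]
        exact pow_le_pow_left₀ (norm_nonneg _) (hxg _ c) 2)
    simp only [hx1] at h
    exact tendsto_nhds_unique h tendsto_const_nhds
  have hMg : ∀ r, Summable fun c => ‖M r c‖ * g c := fun r =>
    summable_mul_of_summable_sq (hMsq r) hgsq
  have hX0 : X = 0 := by
    refine hker X hXsq (fun r => Summable.of_norm_bounded (hMg r) fun c => ?_) fun r => ?_
    · rw [norm_mul]
      exact mul_le_mul_of_nonneg_left (hXg c) (norm_nonneg _)
    · have h := tendsto_tsum_of_dominated_convergence (𝓕 := atTop)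
        (f := fun N c => M r c * x (φ N) c) (g := fun c => M r c * X c) (hMg r)
        (fun c => (hlimr c).const_mul _) (Eventually.of_forall fun N c => by
          rw [norm_mul]
          exact mul_le_mul_of_nonneg_left (hxg _ c) (norm_nonneg _))
      refine tendsto_nhds_unique h ?_
      have hz : Tendsto (fun N => 1 / (((φ N : ℕ) : ℝ) + 1)) atTop (𝓝 0) :=
        tendsto_one_div_add_atTop_nhds_zero_nat.comp hφ.tendsto_atTop
      -- The residual bound holds only for rows inside the truncation; a fixed row is eventually
      -- inside.
      refine squeeze_zero_norm' ?_ hz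
      filter_upwards [(hmt.comp hφ.tendsto_atTop).eventually (hex r)] with N hN
      exact hxM _ r hN
  simp [hX0] at hX1

/-- A square matrix bounded below by `δ > 0` is invertible, with inverse of norm at most `δ⁻¹`. -/
theorem isUnit_and_norm_inv_le_of_bounded_below {κ : Type*} [Fintype κ] [DecidableEq κ]
    {B : Matrix κ κ ℂ} {δ : ℝ} (hδ : 0 < δ)
    (hB : ∀ v : EuclideanSpace ℂ κ, δ * ‖v‖ ≤ ‖WithLp.toLp 2 (B.mulVec v.ofLp)‖) :
    IsUnit B ∧ ‖B⁻¹‖ ≤ δ⁻¹ := by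
  have hu : IsUnit B := by
    rw [← Matrix.mulVec_injective_iff_isUnit,
      ← Matrix.coe_mulVecLin, injective_iff_map_eq_zero]
    intro v hv
    have h := hB (WithLp.toLp 2 v)
    rw [Matrix.mulVecLin_apply] at hv
    simp only [hv, WithLp.toLp_zero, norm_zero] at h
    have h0 : ‖WithLp.toLp 2 v‖ ≤ 0 := by
      by_contra! hc
      exact absurd h (not_le.2 (mul_pos hδ hc))
    simpa using h0
  refine ⟨hu, ?_⟩
  rw [Matrix.l2_opNorm_def]
  refine ContinuousLinearMap.opNorm_le_bound _ (by positivity) fun w => ?_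
  have h := hB (WithLp.toLp 2 (B⁻¹.mulVec w.ofLp))
  simp only [Matrix.mulVec_mulVec, Matrix.mul_nonsing_inv B
    ((Matrix.isUnit_iff_isUnit_det B).1 hu), Matrix.one_mulVec, WithLp.toLp_ofLp] at h
  rw [inv_mul_eq_div, le_div_iff₀ hδ, mul_comm]
  exact h

/-! ### Phasors and harmonic matrices -/

theorem phasor_eq_fourierCoeffOn {T : ℝ} (hT : 0 < T) (a : ℝ → ℂ) (k : ℤ) :
    phasor T a k = fourierCoeffOn hT a k := by
  rw [fourierCoeffOn_eq_integral, phasor, sub_zero, Complex.real_smul]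
  push_cast
  congr 1
  refine intervalIntegral.integral_congr fun τ _ => ?_
  simp only [fourier_coe_apply, smul_eq_mul]
  rw [mul_comm]
  congr 2
  push_cast
  ring

/-- The phasors of a bounded signal are square summable. -/
theorem summable_norm_phasor_sq {T : ℝ} (hT : 0 < T) {a : ℝ → ℂ}
    (ha : MeasureTheory.MemLp a ∞ (MeasureTheory.volume.restrict (Set.Icc 0 T))) :
    Summable fun k => ‖phasor T a k‖ ^ 2 := by
  -- Boundedness enters only through `L²`, where Parseval applies.
  have h2 : MeasureTheory.MemLp a 2 (MeasureTheory.volume.restrict (Set.Ioc 0 T)) :=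
    (ha.mono_measure (MeasureTheory.Measure.restrict_mono Set.Ioc_subset_Icc_self le_rfl)).mono_exponent
      le_top
  simpa only [phasor_eq_fourierCoeffOn hT] using (hasSum_sq_fourierCoeffOn hT h2).summable

theorem harmonicDiag_eq_diagonal (n : ℕ) (T : ℝ) :
    harmonicDiag n T = Matrix.diagonal
      fun r : Fin n × ℤ => Complex.I * ((2 * Real.pi / T * r.2 : ℝ) : ℂ) := by
  rw [harmonicDiag, ← Matrix.diagonal_one, Matrix.diagonal_kronecker_diagonal]
  simp

/-- A family on `Fin n × ℤ` is summable when all its slices are. -/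
theorem hasSum_fin_prod {n : ℕ} {f : Fin n × ℤ → ℝ} (hf : ∀ j, Summable fun k => f (j, k)) :
    HasSum f (∑ j, ∑' k, f (j, k)) := by
  have h : ∀ j : Fin n, HasSum (fun r : Fin n × ℤ => if r.1 = j then f r else 0)
      (∑' k, f (j, k)) := by
    intro j
    have hinj : Function.Injective fun k : ℤ => (j, k) := Prod.mk_right_injective j
    rw [← hinj.hasSum_iff]
    · simpa [Function.comp_def] using (hf j).hasSum
    · rintro ⟨i, k⟩ hik
      exact if_neg fun hij => hik ⟨k, by simp_all⟩
  simpa using hasSum_sum fun j (_ : j ∈ Finset.univ) => h j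

/-- Comparison with `1 / (ωk)²` on each of the `n` slices; this supplies the square-summable
majorant. -/
theorem summable_inv_one_add_norm_harmonic_sq (n : ℕ) {T : ℝ} (hT : 0 < T) :
    Summable fun r : Fin n × ℤ =>
      (1 / (1 + ‖Complex.I * ((2 * Real.pi / T * r.2 : ℝ) : ℂ)‖)) ^ 2 := by
  refine (hasSum_fin_prod fun j => ?_).summable
  have hω : 0 < 2 * Real.pi / T := by positivity
  -- The extra term covers `k = 0`, where `1 / k ^ 2` is `0` by convention.
  have h0 : Summable fun k : ℤ => ((2 * Real.pi / T) ^ 2)⁻¹ * (1 / (k : ℝ) ^ 2) +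
      if k = 0 then (1 : ℝ) else 0 :=
    ((Real.summable_one_div_int_pow.2 one_lt_two).mul_left _).add
      (summable_of_hasFiniteSupport ((Set.finite_singleton 0).subset fun c hc => by
        by_contra h
        exact hc (if_neg h)))
  refine h0.of_nonneg_of_le (fun k => by positivity) fun k => ?_
  by_cases hk : k = 0
  · simp [hk]
  · have hk' : (0 : ℝ) < |(k : ℝ)| := by positivity
    rw [if_neg hk, add_zero, norm_mul, Complex.norm_I, one_mul, Complex.norm_real,
      Real.norm_eq_abs, abs_mul, abs_of_pos hω, ← sq_abs (k : ℝ), ← one_div, one_div_mul_one_div,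
      ← mul_pow, one_div_pow]
    gcongr
    linarith

/-- The rows of a block Toeplitz matrix with bounded symbol are uniformly bounded in `ℓ²`. -/
theorem exists_tsum_blockToeplitz_row_le {n : ℕ} {T : ℝ} (hT : 0 < T)
    {A : ℝ → Matrix (Fin n) (Fin n) ℂ}
    (hA : ∀ i j, MeasureTheory.MemLp (fun t => A t i j) ∞
      (MeasureTheory.volume.restrict (Set.Icc 0 T))) :
    ∃ K : ℝ, 0 ≤ K ∧ ∀ r, (Summable fun c => ‖blockToeplitz T A r c‖ ^ 2) ∧
      ∑' c, ‖blockToeplitz T A r c‖ ^ 2 ≤ K ^ 2 := by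
  set S : Fin n → ℝ := fun i => ∑ j, ∑' k, ‖phasor T (fun t => A t i j) k‖ ^ 2 with hS
  have hS0 : ∀ i, 0 ≤ S i := fun i =>
    Finset.sum_nonneg fun j _ => tsum_nonneg fun k => by positivity
  have hrow : ∀ r, HasSum (fun c => ‖blockToeplitz T A r c‖ ^ 2) (S r.1) := by
    intro r
    obtain ⟨i, l⟩ := r
    -- Reindexing by `k ↦ l - k` removes the dependence on `l`.
    have hsum : ∀ j, HasSum (fun k : ℤ => ‖phasor T (fun t => A t i j) (l - k)‖ ^ 2)
        (∑' k, ‖phasor T (fun t => A t i j) k‖ ^ 2) := fun j =>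
      (Equiv.subLeft l).hasSum_iff.2 (summable_norm_phasor_sq hT (hA i j)).hasSum
    have h := hasSum_fin_prod (f := fun c => ‖phasor T (fun t => A t i c.1) (l - c.2)‖ ^ 2)
      fun j => (hsum j).summable
    simp only [fun j => (hsum j).tsum_eq] at h
    exact h
  refine ⟨√(∑ i, S i), Real.sqrt_nonneg _, fun r => ⟨(hrow r).summable, ?_⟩⟩
  rw [(hrow r).tsum_eq, Real.sq_sqrt (Finset.sum_nonneg fun i _ => hS0 i)]
  exact Finset.single_le_sum (fun i _ => hS0 i) (Finset.mem_univ _)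

/-- An invertible matrix operator has trivial kernel. -/
theorem IsInvertibleOp.eq_zero {ι : Type} {M : Matrix ι ι ℂ} (hM : IsInvertibleOp M)
    {X : ι → ℂ} (hX : Summable fun c => ‖X c‖ ^ 2) (hs : ∀ r, Summable fun c => M r c * X c)
    (h0 : ∀ r, ∑' c, M r c * X c = 0) : X = 0 := by
  have hXm : Memℓp X 2 := memℓp_gen (by simpa using hX)
  have hdom : (⟨X, hXm⟩ : Ell2 ι) ∈ (matrixOp M).domain := by
    refine ⟨hs, ?_⟩
    have : (fun r => ∑' c, M r c * X c) = 0 := funext h0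
    change Memℓp (fun r => ∑' c, M r c * X c) 2
    rw [this]
    exact zero_memℓp
  have h : (⟨⟨X, hXm⟩, hdom⟩ : (matrixOp M).domain) = 0 := by
    apply hM.1
    rw [LinearPMap.map_zero]
    ext r
    exact h0 r
  have h' := congrArg (fun Y : (matrixOp M).domain => ((Y : Ell2 ι) : ι → ℂ)) h
  exact h'

end HarmonicOperator

theorem mainTheorem7 (n : ℕ) (T : ℝ) (hT : 0 < T)
    (A : ℝ → Matrix (Fin n) (Fin n) ℂ) (hper : Function.Periodic A T)
    (hA : ∀ i j, MeasureTheory.MemLp (fun t => A t i j) ∞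
      (MeasureTheory.volume.restrict (Set.Icc 0 T)))
    (hinv : HarmonicOperator.IsInvertibleOp
      (HarmonicOperator.blockToeplitz T A - HarmonicOperator.harmonicDiag n T)) :
    ∃ m₀ : ℕ, 0 < m₀ ∧
      (∀ m ≥ m₀, IsUnit (HarmonicOperator.trunc m (HarmonicOperator.blockToeplitz T A) -
        HarmonicOperator.trunc m (HarmonicOperator.harmonicDiag n T))) ∧
      ∃ C : ℝ, ∀ m ≥ m₀,
        ‖(HarmonicOperator.trunc m (HarmonicOperator.blockToeplitz T A) -
          HarmonicOperator.trunc m (HarmonicOperator.harmonicDiag n T))⁻¹‖ ≤ C := by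
  obtain ⟨K, hK, hrow⟩ := HarmonicOperator.exists_tsum_blockToeplitz_row_le hT hA
  have hd := HarmonicOperator.summable_inv_one_add_norm_harmonic_sq n hT
  have hdiag := HarmonicOperator.harmonicDiag_eq_diagonal n T
  have hinj : ∀ m : ℕ, Function.Injective fun r : HarmonicOperator.TruncIndex n m =>
      (r.1, (r.2 : ℤ)) := by
    rintro m ⟨i, k⟩ ⟨j, l⟩ h
    simp only [Prod.mk.injEq] at h
    exact Prod.ext h.1 (Subtype.ext h.2)
  obtain ⟨m₁, δ, hδ, hb⟩ := HarmonicOperator.exists_finiteSection_bounded_below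
    (κ := HarmonicOperator.TruncIndex n) (fun m r => (r.1, (r.2 : ℤ))) hinj
    (fun r => by
      filter_upwards [Filter.eventually_ge_atTop r.2.natAbs] with m hm
      exact ⟨(r.1, ⟨r.2, Finset.mem_Icc.2 (by omega)⟩), rfl⟩)
    (HarmonicOperator.blockToeplitz T A) _ hK (fun r => (hrow r).1) (fun r => (hrow r).2) hd
    (fun X hX hs h0 => by
      rw [← hdiag] at hs h0
      exact hinv.eq_zero hX hs h0)
  rw [← hdiag] at hb
  -- `m₁ + 1` rather than `m₁` ensures positivity of the threshold.
  have key := fun (m : ℕ) (hm : m ≥ m₁ + 1) =>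
    HarmonicOperator.isUnit_and_norm_inv_le_of_bounded_below hδ (hb m (by omega))
  exact ⟨m₁ + 1, m₁.succ_pos, fun m hm => (key m hm).1, δ⁻¹, fun m hm => (key m hm).2⟩
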